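/- Let $H$ be a nonempty, bounded, open subset of $\mathbb R^n$, let $\|\cdot\|$ be any fixed norm on $\mathbb R^n$, and let $\bar H$ carry the metric $d(x,y)=\|x-y\|$. Let $\mathcal B$ be a countably infinite index set and let $\theta_\beta:\bar H\to\bar H$ and $b_\beta:\bar H\to(0,\infty)$, $\beta\in\mathcal B$, be continuous. A family of maps is called uniformly Lipschitz if one constant is a Lipschitz constant for all of its members. Assume that the families $\{\theta_\beta\}$, $\{b_\beta\}$ and $\{\log b_\beta\}$ are uniformly Lipschitz, and that $b(x):=\sum_{\beta\in\mathcal B}b_\beta(x)<\infty$ for all $x\in\bar H$, with $b$ continuous on $\bar H$. For $\nu\ge1$ and a word $\omega=(j_1,\dots,j_\nu)\in\mathcal B_\nu:=\mathcal B^\nu$ put $\theta_\omega=\theta_{j_\nu}\circ\cdots\circ\theta_{j_1}$, and define $b_\omega$ inductively by $b_{(j_1)}=b_{j_1}$ and $b_\omega(x)=b_{j_\nu}\big(\theta_{(j_1,\dots,j_{\nu-1})}(x)\big)\,b_{(j_1,\dots,j_{\nu-1})}(x)$. Assume that there are an integer $\mu\ge1$ and a constant $0\le\kappa<1$ such that $\operatorname{Lip}(\theta_\omega)\le\kappa$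 for all $\omega\in\mathcal B_\mu$. Let $C(\bar H)$ be the real Banach space of continuous functions $f:\bar H\to\mathbb R$ with the sup norm. For $M>0$ let $$K(M;\bar H)=\{f\in C(\bar H): f(x)\ge0\text{ and } f(y)\le f(x)\,e^{M d(x,y)}\text{ for all }x,y\in\bar H\},$$ and let $L:C(\bar H)\to C(\bar H)$ be the bounded linear operator $(Lf)(x)=\sum_{\beta\in\mathcal B}b_\beta(x)f(\theta_\beta(x))$. The spectral radius $r(L)$, the eigenvalues and the algebraic multiplicities of $L$ are those of its complexification $\tilde L$ on $C(\bar H;\mathbb C)$, where the algebraic multiplicity of an eigenvalue $\lambda$ is $\dim_{\mathbb C}\bigcup_{k\ge1}\ker(\lambda-\tilde L)^k$. Then: 1. With $c=\kappa^{1/\mu}$, there is a constant $A$ such that $\operatorname{Lip}(\theta_\omega)\le A c^\nu$ for all $\nu\ge1$ and all $\omega\in\mathcal B_\nu$ (if $\kappa=0$, this is asserted for $\nu\ge\mu$ only). 2. For each $\nu\ge1$ the family $\{\log b_\omega:\omega\in\mathcal B_\nu\}$ is uniformly Lipschitz; moreover there is $M_0>0$ such that $b_\omega\in K(M_0;\bar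 H)$ for all $\omega\in\mathcal B_\mu$. 3. $r:=r(L)>0$, and there is $v\in C(\bar H)$ with $v(x)>0$ for all $x\in\bar H$ and $Lv=rv$, such that $v\in K(M_0/(1-\kappa);\bar H)$ for every $M_0>0$ as in 2. 4. The eigenvalue $r$ of $L$ has algebraic multiplicity one, and $r$ is the only eigenvalue of $L$ of modulus $r$. -/

import Mathlib

open Filter Topology

noncomputable section

namespace PositiveTransfer

section Words

variable {S B : Type*} [TopologicalSpace S]

/-- The map `θ_ω = θ_{j_n} ∘ ⋯ ∘ θ_{j_1}` of a word `ω = (j_1, …, j_n)`. -/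
def wordMap (θ : B → C(S, S)) : (n : ℕ) → (Fin n → B) → C(S, S)
  | 0, _ => ContinuousMap.id S
  | n + 1, ω => (θ (ω (Fin.last n))).comp (wordMap θ n (fun i => ω i.castSucc))

/-- The weight `b_ω` of a word `ω = (j_1, …, j_n)`:
`b_ω(x) = b_{j_n}(θ_{(j_1, …, j_{n-1})}(x)) * b_{(j_1, …, j_{n-1})}(x)`, starting from
`1` for the empty word. -/
def wordWeight (θ : B → C(S, S)) (b : B → C(S, ℝ)) : (n : ℕ) → (Fin n → B) → C(S, ℝ)
  | 0, _ => 1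
  | n + 1, ω =>
      ((b (ω (Fin.last n))).comp (wordMap θ n (fun i => ω i.castSucc))) *
        wordWeight θ b n (fun i => ω i.castSucc)

end Words

/-- A family of maps between metric spaces is uniformly Lipschitz if one constant serves as a
Lipschitz constant for every member. -/
def UniformlyLipschitz {ι X Y : Type*} [PseudoMetricSpace X] [PseudoMetricSpace Y]
    (f : ι → X → Y) : Prop :=
  ∃ M : ℝ, ∀ i, ∀ x y, dist (f i x) (f i y) ≤ M * dist x y

/-- The cone `K(M; S)` of the nonnegative `f ∈ C(S)` with `f(y) ≤ f(x) exp(M d(x, y))`. -/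
def logLipCone (S : Type*) [MetricSpace S] (M : ℝ) : Set C(S, ℝ) :=
  {f | (∀ x, 0 ≤ f x) ∧ ∀ x y, f y ≤ f x * Real.exp (M * dist x y)}

section Operator

variable {S B : Type*} [TopologicalSpace S] [CompactSpace S]

theorem transfer_norm_term_le (θ : B → C(S, S)) (b : B → C(S, ℝ)) (hpos : ∀ β x, 0 < b β x)
    (f : C(S, ℝ)) (x : S) (β : B) : ‖b β x * f (θ β x)‖ ≤ b β x * ‖f‖ := by
  rw [norm_mul, Real.norm_of_nonneg (hpos β x).le]
  exact mul_le_mul_of_nonneg_left (f.norm_coe_le_norm _) (hpos β x).le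

theorem transfer_summable (θ : B → C(S, S)) (b : B → C(S, ℝ)) (hpos : ∀ β x, 0 < b β x)
    (hsum : ∀ x, Summable fun β => b β x) (f : C(S, ℝ)) (x : S) :
    Summable fun β => b β x * f (θ β x) :=
  Summable.of_norm_bounded ((hsum x).mul_right ‖f‖) (transfer_norm_term_le θ b hpos f x)

theorem transfer_continuous (θ : B → C(S, S)) (b : B → C(S, ℝ)) (hpos : ∀ β x, 0 < b β x)
    (hsum : ∀ x, Summable fun β => b β x) (hcont : Continuous fun x => ∑' β, b β x)
    (f : C(S, ℝ)) : Continuous fun x => ∑' β, b β x * f (θ β x) := by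
  have dini : TendstoUniformly (fun (s : Finset B) x => ∑ β ∈ s, b β x)
      (fun x => ∑' β, b β x) atTop := by
    refine Monotone.tendstoUniformly_of_forall_tendsto (fun s => by fun_prop) ?_ hcont
      (fun x => (hsum x).hasSum)
    intro s t hst x
    exact Finset.sum_le_sum_of_subset_of_nonneg hst fun β _ _ => (hpos β x).le
  have key : TendstoUniformly (fun (s : Finset B) x => ∑ β ∈ s, b β x * f (θ β x))
      (fun x => ∑' β, b β x * f (θ β x)) atTop := by
    rw [Metric.tendstoUniformly_iff] at dini ⊢
    intro ε hε
    filter_upwards [dini (ε / (‖f‖ + 1)) (by positivity)] with s hs x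
    have h1 := hs x
    have e1 := (hsum x).sum_add_tsum_compl (s := s)
    have e2 := (transfer_summable θ b hpos hsum f x).sum_add_tsum_compl (s := s)
    have n1 : (0 : ℝ) ≤ ∑' β : ↑((s : Set B)ᶜ), b β x := tsum_nonneg fun β => (hpos β x).le
    rw [Real.dist_eq, ← e1, add_sub_cancel_left, abs_of_nonneg n1,
      lt_div_iff₀ (by positivity)] at h1
    rw [Real.dist_eq, ← e2, add_sub_cancel_left, ← Real.norm_eq_abs]
    have h2 : ‖∑' β : ↑((s : Set B)ᶜ), b β x * f (θ β x)‖
        ≤ (∑' β : ↑((s : Set B)ᶜ), b β x) * ‖f‖ :=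
      tsum_of_norm_bounded (((hsum x).subtype _).hasSum.mul_right ‖f‖)
        fun β => transfer_norm_term_le θ b hpos f x β
    nlinarith
  exact key.continuous (Frequently.of_forall fun s => by fun_prop)

/-- The bounded operator `(L f)(x) = ∑_β b_β(x) f(θ_β(x))` on `C(S)`. -/
def transferOperator (θ : B → C(S, S)) (b : B → C(S, ℝ)) (hpos : ∀ β x, 0 < b β x)
    (hsum : ∀ x, Summable fun β => b β x) (hcont : Continuous fun x => ∑' β, b β x) :
    C(S, ℝ) →L[ℝ] C(S, ℝ) :=
  LinearMap.mkContinuous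
    { toFun := fun f =>
        ⟨fun x => ∑' β, b β x * f (θ β x), transfer_continuous θ b hpos hsum hcont f⟩
      map_add' := fun f g => by
        ext x
        simpa [mul_add] using (transfer_summable θ b hpos hsum f x).tsum_add
          (transfer_summable θ b hpos hsum g x)
      map_smul' := fun c f => by
        ext x
        simp [mul_left_comm, tsum_mul_left] }
    ‖(⟨fun x => ∑' β, b β x, hcont⟩ : C(S, ℝ))‖ (fun f => by
      refine (ContinuousMap.norm_le _ (by positivity)).2 fun x => ?_
      refine (tsum_of_norm_bounded ((hsum x).hasSum.mul_right ‖f‖)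
        (transfer_norm_term_le θ b hpos f x)).trans ?_
      refine mul_le_mul_of_nonneg_right ?_ (norm_nonneg f)
      exact (le_abs_self _).trans
        (ContinuousMap.norm_coe_le_norm (⟨fun x => ∑' β, b β x, hcont⟩ : C(S, ℝ)) x))

theorem transferOperator_apply (θ : B → C(S, S)) (b : B → C(S, ℝ)) (hpos : ∀ β x, 0 < b β x)
    (hsum : ∀ x, Summable fun β => b β x) (hcont : Continuous fun x => ∑' β, b β x)
    (f : C(S, ℝ)) (x : S) :
    transferOperator θ b hpos hsum hcont f x = ∑' β, b β x * f (θ β x) := rfl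

/-- The real part of `f ∈ C(S, ℂ)`. -/
def rePart (f : C(S, ℂ)) : C(S, ℝ) := ⟨fun x => (f x).re, by fun_prop⟩

/-- The imaginary part of `f ∈ C(S, ℂ)`. -/
def imPart (f : C(S, ℂ)) : C(S, ℝ) := ⟨fun x => (f x).im, by fun_prop⟩

theorem norm_rePart_le (f : C(S, ℂ)) : ‖rePart f‖ ≤ ‖f‖ :=
  (ContinuousMap.norm_le _ (norm_nonneg f)).2 fun x =>
    (Complex.abs_re_le_norm (f x)).trans (f.norm_coe_le_norm x)

theorem norm_imPart_le (f : C(S, ℂ)) : ‖imPart f‖ ≤ ‖f‖ :=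
  (ContinuousMap.norm_le _ (norm_nonneg f)).2 fun x =>
    (Complex.abs_im_le_norm (f x)).trans (f.norm_coe_le_norm x)

/-- The complexification `g + i h ↦ T g + i T h` on `C(S, ℂ)` of an operator `T` on the real
Banach space `C(S)`. -/
def complexification (T : C(S, ℝ) →L[ℝ] C(S, ℝ)) : C(S, ℂ) →L[ℂ] C(S, ℂ) :=
  LinearMap.mkContinuous
    { toFun := fun f =>
        ⟨fun x => (T (rePart f) x : ℂ) + Complex.I * (T (imPart f) x : ℂ), by fun_prop⟩
      map_add' := fun f g => by
        have h1 : rePart (f + g) = rePart f + rePart g := by ext x; simp [rePart]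
        have h2 : imPart (f + g) = imPart f + imPart g := by ext x; simp [imPart]
        ext x
        simp only [h1, h2, map_add, ContinuousMap.coe_mk, ContinuousMap.add_apply,
          Complex.ofReal_add]
        ring
      map_smul' := fun c f => by
        have h1 : rePart (c • f) = c.re • rePart f - c.im • imPart f := by
          ext x; simp [rePart, imPart]
        have h2 : imPart (c • f) = c.re • imPart f + c.im • rePart f := by
          ext x; simp [rePart, imPart]
        ext x
        simp only [h1, h2, map_add, map_sub, map_smul, ContinuousMap.coe_mk,
          ContinuousMap.add_apply, ContinuousMap.sub_apply, ContinuousMap.smul_apply,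
          smul_eq_mul, RingHom.id_apply]
        apply Complex.ext <;> simp }
    (‖T‖ + ‖T‖) (fun f => by
      refine (ContinuousMap.norm_le _ (by positivity)).2 fun x => ?_
      have h1 : ‖T (rePart f) x‖ ≤ ‖T‖ * ‖f‖ :=
        ((T (rePart f)).norm_coe_le_norm x).trans ((T.le_opNorm _).trans
          (mul_le_mul_of_nonneg_left (norm_rePart_le f) (norm_nonneg T)))
      have h2 : ‖T (imPart f) x‖ ≤ ‖T‖ * ‖f‖ :=
        ((T (imPart f)).norm_coe_le_norm x).trans ((T.le_opNorm _).trans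
          (mul_le_mul_of_nonneg_left (norm_imPart_le f) (norm_nonneg T)))
      refine (norm_add_le _ _).trans ?_
      rw [norm_mul, Complex.norm_I, one_mul, Complex.norm_real, Complex.norm_real]
      linarith)

theorem complexification_apply (T : C(S, ℝ) →L[ℝ] C(S, ℝ)) (f : C(S, ℂ)) (x : S) :
    complexification T f x = (T (rePart f) x : ℂ) + Complex.I * (T (imPart f) x : ℂ) := rfl

/-- The spectral radius `r(T)` of an operator on the real space `C(S)`, that is, the spectral
radius of its complexification. -/
def specRadius (T : C(S, ℝ) →L[ℝ] C(S, ℝ)) : ℝ :=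
  (spectralRadius ℂ (complexification T)).toReal

/-- The algebraic multiplicity of `z` as an eigenvalue of `T`: the complex dimension of
`⋃ₖ ker (z - T)ᵏ`, formed for the complexification; it is a cardinal. -/
def algMultiplicity (T : C(S, ℝ) →L[ℝ] C(S, ℝ)) (z : ℂ) : Cardinal :=
  Module.rank ℂ (Module.End.maxGenEigenspace
    (complexification T : C(S, ℂ) →ₗ[ℂ] C(S, ℂ)) z)

/-- `z` is an eigenvalue of `T`, in the sense of an eigenvalue of its complexification. -/
def IsEigenvalue (T : C(S, ℝ) →L[ℝ] C(S, ℝ)) (z : ℂ) : Prop :=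
  Module.End.HasEigenvalue (complexification T : C(S, ℂ) →ₗ[ℂ] C(S, ℂ)) z

end Operator

end PositiveTransfer

end

noncomputable section

namespace PositiveTransfer

/-! ### Lipschitz bounds along words. -/

section Words

variable {S B : Type*}

/-! The power `L ^ μ` is again a transfer operator, with contractions and log-Lipschitz weights
indexed by words of length `μ`. It sends `K(M)` into `K(M₀ + κ M)`, which is invariance for `M = M₀
/ (1 - κ)` and a strict gain for larger `M`. On a compact space, functions in such a cone satisfy a
Harnack inequality: any two values differ by at most a fixed factor.

Existence (`exists_pos_eigenvector`): by Harnack, the norms of `T ^ n 1`, with `T = L ^ μ`, are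
multiplicative up to a constant, hence comparable to `R ^ n`. Cesàro averages of `R⁻ⁿ Tⁿ 1` lie in a
compact part of the cone, and a limit point `v` is a positive eigenvector.

Uniqueness (`exists_contraction`, `eventually_near_span`): put `Q = R⁻¹ L ^ μ`. The strict gain
permits subtracting a definite multiple of `v` from `Q f` without leaving the cone, so remainders
decay geometrically and `Q ^ n f` approaches the line of `v`, first for `f` in the cone, then by
density for all `f`. Since `L v` is fixed by `Q`, it lies on that line, so `v` is an eigenvector of
`L` itself. Positivity identifies its eigenvalue with the spectral radius, and the convergence puts
every generalized eigenvector for it, and every eigenvector of the same modulus, on the complex line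
of `v` (`mem_span_of_complexification_eq`). -/

theorem wordMap_add [TopologicalSpace S] (θ : B → C(S, S)) (m n : ℕ) (ω : Fin (m + n) → B) :
    wordMap θ (m + n) ω = (wordMap θ n fun i => ω (Fin.natAdd m i)).comp
      (wordMap θ m fun i => ω (Fin.castAdd n i)) := by
  induction n with
  | zero => rfl
  | succ n ih =>
    change (θ (ω (Fin.last (m + n)))).comp (wordMap θ (m + n) fun i => ω i.castSucc) = _
    rw [ih]
    rfl

theorem lipschitzWith_wordMap [PseudoMetricSpace S] {θ : B → C(S, S)} {D : NNReal}
    (hD : ∀ β, LipschitzWith D (θ β)) (n : ℕ) (ω : Fin n → B) :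
    LipschitzWith (D ^ n) (wordMap θ n ω) := by
  induction n with
  | zero => rw [pow_zero]; exact LipschitzWith.id
  | succ n ih => rw [pow_succ']; exact (hD _).comp (ih _)

theorem UniformlyLipschitz.exists_nnreal {ι X Y : Type*} [PseudoMetricSpace X]
    [PseudoMetricSpace Y] {f : ι → X → Y} (h : UniformlyLipschitz f) :
    ∃ D : NNReal, 1 ≤ D ∧ ∀ i, LipschitzWith D (f i) := by
  obtain ⟨M, hM⟩ := h
  refine ⟨max 1 M.toNNReal, le_max_left _ _, fun i => LipschitzWith.of_dist_le_mul fun x y => ?_⟩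
  refine (hM i x y).trans (mul_le_mul_of_nonneg_right ?_ dist_nonneg)
  exact (Real.le_coe_toNNReal M).trans (NNReal.coe_le_coe.2 (le_max_right _ _))

/-- Each block of `μ` letters contributes a factor `κ = c ^ μ`; fewer than `μ` letters remain, and
they are absorbed in the constant. For `κ = 0` every word of length at least `μ` is constant, so `A
= 0` works. -/
theorem exists_lipschitzWith_wordMap [PseudoMetricSpace S] {θ : B → C(S, S)}
    (hθ : UniformlyLipschitz fun β x => θ β x) {μ : ℕ} (hμ : 1 ≤ μ) {κ : NNReal} (hκ : κ < 1)
    (hcontr : ∀ ω : Fin μ → B, LipschitzWith κ (wordMap θ μ ω)) :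
    ∃ A : NNReal, ∀ ν : ℕ, 1 ≤ ν → (0 < κ ∨ μ ≤ ν) → ∀ ω : Fin ν → B,
      LipschitzWith (A * (κ ^ (1 / (μ : ℝ))) ^ ν) (wordMap θ ν ω) := by
  obtain ⟨D, hD1, hD⟩ := hθ.exists_nnreal
  rcases eq_or_ne κ 0 with rfl | hκ0
  · refine ⟨0, fun ν _ h ω => ?_⟩
    obtain ⟨n, rfl⟩ := Nat.exists_eq_add_of_le (h.resolve_left (lt_irrefl _))
    have := (lipschitzWith_wordMap hD n fun i => ω (Fin.natAdd μ i)).comp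
      (hcontr fun i => ω (Fin.castAdd n i))
    rw [wordMap_add, zero_mul]
    rw [mul_zero] at this
    exact this
  set c : NNReal := κ ^ (1 / (μ : ℝ)) with hc
  have hcμ : c ^ μ = κ := by
    rw [hc, ← NNReal.rpow_natCast, ← NNReal.rpow_mul, one_div_mul_cancel (by positivity),
      NNReal.rpow_one]
  have hc1 : c ≤ 1 := NNReal.rpow_le_one hκ.le (by positivity)
  -- The factor `κ⁻¹` compensates `c ^ ν ≥ c ^ μ = κ` for words shorter than `μ`.
  refine ⟨D ^ μ * κ⁻¹, fun ν _ _ => ?_⟩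
  induction ν using Nat.strong_induction_on with
  | _ ν ih =>
  intro ω
  rcases lt_or_ge ν μ with h | h
  · refine (lipschitzWith_wordMap hD ν ω).weaken ?_
    calc D ^ ν ≤ D ^ μ := pow_le_pow_right₀ hD1 h.le
      _ = D ^ μ * κ⁻¹ * c ^ μ := by rw [hcμ, inv_mul_cancel_right₀ hκ0]
      _ ≤ D ^ μ * κ⁻¹ * c ^ ν := by gcongr _ * ?_; exact pow_le_pow_of_le_one zero_le hc1 h.le
  · obtain ⟨n, rfl⟩ := Nat.exists_eq_add_of_le h
    rw [wordMap_add]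
    rcases Nat.eq_zero_or_pos n with rfl | hn
    · refine (LipschitzWith.id.comp (hcontr _)).weaken ?_
      rw [add_zero, hcμ, one_mul, inv_mul_cancel_right₀ hκ0]
      calc κ ≤ 1 := hκ.le
        _ ≤ D ^ μ := one_le_pow₀ hD1
    · refine ((ih n (by omega) hn (Or.inl (pos_iff_ne_zero.2 hκ0)) _).comp
        (hcontr fun i => ω (Fin.castAdd n i))).weaken (le_of_eq ?_)
      rw [pow_add, hcμ]
      ring

theorem wordWeight_pos [TopologicalSpace S] {θ : B → C(S, S)} {b : B → C(S, ℝ)}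
    (hpos : ∀ β x, 0 < b β x) (n : ℕ) (ω : Fin n → B) (x : S) : 0 < wordWeight θ b n ω x := by
  induction n with
  | zero => exact one_pos
  | succ n ih => exact mul_pos (hpos _ _) (ih _)

theorem uniformlyLipschitz_log_wordWeight [PseudoMetricSpace S] {θ : B → C(S, S)}
    {b : B → C(S, ℝ)} (hpos : ∀ β x, 0 < b β x) (hθ : UniformlyLipschitz fun β x => θ β x)
    (hlog : UniformlyLipschitz fun β x => Real.log (b β x)) (n : ℕ) :
    UniformlyLipschitz fun (ω : Fin n → B) x => Real.log (wordWeight θ b n ω x) := by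
  obtain ⟨D, -, hD⟩ := hθ.exists_nnreal
  obtain ⟨N, -, hN⟩ := hlog.exists_nnreal
  induction n with
  | zero => exact ⟨0, fun ω x y => by simp [wordWeight]⟩
  | succ n ih =>
    obtain ⟨M, hM⟩ := ih
    refine ⟨N * D ^ n + M, fun ω x y => ?_⟩
    have key : ∀ z, Real.log (wordWeight θ b (n + 1) ω z) =
        Real.log (b (ω (Fin.last n)) (wordMap θ n (fun i => ω i.castSucc) z)) +
          Real.log (wordWeight θ b n (fun i => ω i.castSucc) z) := fun z =>
      Real.log_mul (hpos _ _).ne' (wordWeight_pos hpos _ _ _).ne'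
    simp only [key]
    refine (dist_add_add_le _ _ _ _).trans ?_
    rw [add_mul]
    refine add_le_add ?_ (hM _ x y)
    have := ((hN (ω (Fin.last n))).comp
      (lipschitzWith_wordMap hD n fun i => ω i.castSucc)).dist_le_mul x y
    simpa using this

theorem exists_wordWeight_mem_logLipCone [MetricSpace S] {θ : B → C(S, S)}
    {b : B → C(S, ℝ)} (hpos : ∀ β x, 0 < b β x) (hθ : UniformlyLipschitz fun β x => θ β x)
    (hlog : UniformlyLipschitz fun β x => Real.log (b β x)) (n : ℕ) :
    ∃ M : ℝ, 0 < M ∧ ∀ ω : Fin n → B, wordWeight θ b n ω ∈ logLipCone S M := by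
  obtain ⟨M, hM1, hM⟩ := (uniformlyLipschitz_log_wordWeight hpos hθ hlog n).exists_nnreal
  refine ⟨M, by exact_mod_cast zero_lt_one.trans_le hM1, fun ω =>
    ⟨fun x => (wordWeight_pos hpos n ω x).le, fun x y => ?_⟩⟩
  have h := (hM ω).dist_le_mul y x
  rw [Real.dist_eq, dist_comm] at h
  rw [← Real.exp_log (wordWeight_pos (θ := θ) hpos n ω x), ← Real.exp_add,
    ← Real.log_le_iff_le_exp (wordWeight_pos hpos n ω y)]
  linarith [le_abs_self (Real.log (wordWeight θ b n ω y) - Real.log (wordWeight θ b n ω x))]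

end Words

/-! ### Powers of the transfer operator as sums over words. -/

section Powers

variable {S B : Type*} [MetricSpace S] [CompactSpace S] {θ : B → C(S, S)} {b : B → C(S, ℝ)}
  (hpos : ∀ β x, 0 < b β x) (hsum : ∀ x, Summable fun β => b β x)
  (hcont : Continuous fun x => ∑' β, b β x)

theorem transferOperator_nonneg {f : C(S, ℝ)} (hf : ∀ x, 0 ≤ f x) (x : S) :
    0 ≤ transferOperator θ b hpos hsum hcont f x :=
  tsum_nonneg fun β => mul_nonneg (hpos β x).le (hf _)

theorem transferOperator_pos [Nonempty B] {f : C(S, ℝ)} (hf : ∀ x, 0 < f x) (x : S) :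
    0 < transferOperator θ b hpos hsum hcont f x :=
  (transfer_summable θ b hpos hsum f x).tsum_pos (fun β => (mul_pos (hpos β x) (hf _)).le)
    (Classical.arbitrary B) (mul_pos (hpos _ x) (hf _))

/-- Nonnegativity of `f` makes the iterated sum over a word and a further letter summable as a
double sum; appending the letter then reindexes it by longer words. -/
theorem hasSum_transferOperator_pow {f : C(S, ℝ)} (hf : ∀ x, 0 ≤ f x) (n : ℕ) (x : S) :
    HasSum (fun ω : Fin n → B => wordWeight θ b n ω x * f (wordMap θ n ω x))
      ((transferOperator θ b hpos hsum hcont ^ n) f x) := by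
  induction n generalizing f with
  | zero =>
    simp [wordWeight, wordMap]
  | succ n ih =>
    set L := transferOperator θ b hpos hsum hcont with hL
    have h1 := ih (f := L f) (transferOperator_nonneg hpos hsum hcont hf)
    let F : (Fin n → B) × B → ℝ := fun p =>
      wordWeight θ b n p.1 x * (b p.2 (wordMap θ n p.1 x) * f (θ p.2 (wordMap θ n p.1 x)))
    have hfib : ∀ ω, HasSum (fun β => F (ω, β))
        (wordWeight θ b n ω x * L f (wordMap θ n ω x)) := fun ω =>
      (transfer_summable θ b hpos hsum f _).hasSum.mul_left _
    have hF : Summable F := by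
      refine (summable_prod_of_nonneg fun p => ?_).2 ⟨fun ω => (hfib ω).summable, ?_⟩
      · exact mul_nonneg (wordWeight_pos hpos n _ x).le (mul_nonneg (hpos _ _).le (hf _))
      · simpa only [(hfib _).tsum_eq] using h1.summable
    have hF' : HasSum F ((L ^ (n + 1)) f x) := by
      have h2 := (hF.hasSum.prod_fiberwise hfib).unique h1
      rw [pow_succ]
      change HasSum F ((L ^ n) (L f) x)
      rw [← h2]
      exact hF.hasSum
    let e := (Equiv.prodComm _ _).trans (Fin.snocEquiv fun _ : Fin (n + 1) => B)
    rw [← e.hasSum_iff]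
    convert hF' using 1
    ext p
    simp only [e, F, Function.comp, wordWeight, wordMap, Equiv.trans_apply, Fin.snocEquiv,
      Equiv.coe_fn_mk, Equiv.prodComm_apply, Fin.snoc_last, Fin.snoc_castSucc,
      ContinuousMap.mul_apply, ContinuousMap.comp_apply, Prod.fst_swap, Prod.snd_swap]
    ring

/-- The weights cost `M₀`, while `f` is evaluated at points brought closer by the factor `κ`, which
costs only `κ * M`. -/
theorem transferOperator_pow_mem_logLipCone {μ : ℕ} {κ : NNReal}
    (hcontr : ∀ ω : Fin μ → B, LipschitzWith κ (wordMap θ μ ω)) {M₀ M : ℝ} (hM : 0 ≤ M)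
    (hw : ∀ ω : Fin μ → B, wordWeight θ b μ ω ∈ logLipCone S M₀) {f : C(S, ℝ)}
    (hf : f ∈ logLipCone S M) :
    (transferOperator θ b hpos hsum hcont ^ μ) f ∈ logLipCone S (M₀ + κ * M) := by
  have hs := hasSum_transferOperator_pow (θ := θ) hpos hsum hcont hf.1 μ
  refine ⟨fun x => (hs x).nonneg fun ω =>
    mul_nonneg (wordWeight_pos hpos μ ω x).le (hf.1 _), fun x y => ?_⟩
  refine hasSum_le (fun ω => ?_) (hs y) ((hs x).mul_right _)
  calc wordWeight θ b μ ω y * f (wordMap θ μ ω y)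
      ≤ (wordWeight θ b μ ω x * Real.exp (M₀ * dist x y)) *
        (f (wordMap θ μ ω x) * Real.exp (M * dist (wordMap θ μ ω x) (wordMap θ μ ω y))) := by
        gcongr
        · exact hf.1 _
        · exact mul_nonneg ((hw ω).1 x) (Real.exp_pos _).le
        · exact (hw ω).2 x y
        · exact hf.2 _ _
    _ ≤ (wordWeight θ b μ ω x * Real.exp (M₀ * dist x y)) *
        (f (wordMap θ μ ω x) * Real.exp (M * (κ * dist x y))) := by
        gcongr
        · exact mul_nonneg ((hw ω).1 x) (Real.exp_pos _).le
        · exact hf.1 _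
        · exact (hcontr ω).dist_le_mul x y
    _ = _ := by
        rw [show (M₀ + κ * M) * dist x y = M₀ * dist x y + M * (κ * dist x y) by ring,
          Real.exp_add]
        ring

end Powers

/-! ### The log-Lipschitz cone: Harnack inequality and compactness. -/

section Cone

variable {S : Type*} [MetricSpace S]

theorem logLipCone_smul_mem {M : ℝ} {f : C(S, ℝ)} (hf : f ∈ logLipCone S M) {c : ℝ}
    (hc : 0 ≤ c) : c • f ∈ logLipCone S M :=
  ⟨fun x => mul_nonneg hc (hf.1 x), fun x y => by
    simpa [mul_assoc] using mul_le_mul_of_nonneg_left (hf.2 x y) hc⟩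

theorem logLipCone_add_mem {M : ℝ} {f g : C(S, ℝ)} (hf : f ∈ logLipCone S M)
    (hg : g ∈ logLipCone S M) : f + g ∈ logLipCone S M :=
  ⟨fun x => add_nonneg (hf.1 x) (hg.1 x), fun x y => by
    simpa [add_mul] using add_le_add (hf.2 x y) (hg.2 x y)⟩

theorem logLipCone_sum_mem {M : ℝ} {ι : Type*} (s : Finset ι) {f : ι → C(S, ℝ)}
    (hf : ∀ i, f i ∈ logLipCone S M) : ∑ i ∈ s, f i ∈ logLipCone S M := by
  classical
  induction s using Finset.induction_on with
  | empty => exact ⟨fun x => by simp, fun x y => by simp⟩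
  | insert i s hi ih => rw [Finset.sum_insert hi]; exact logLipCone_add_mem (hf i) ih

theorem one_mem_logLipCone {M : ℝ} (hM : 0 ≤ M) : (1 : C(S, ℝ)) ∈ logLipCone S M :=
  ⟨fun x => zero_le_one, fun x y => by
    simpa using mul_nonneg hM dist_nonneg⟩

theorem logLipCone_mono {M N : ℝ} (h : M ≤ N) : logLipCone S M ⊆ logLipCone S N :=
  fun f hf => ⟨hf.1, fun x y => (hf.2 x y).trans <|
    mul_le_mul_of_nonneg_left (by gcongr) (hf.1 x)⟩

theorem isClosed_logLipCone (M : ℝ) : IsClosed (logLipCone S M) := by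
  have : logLipCone S M = (⋂ x, {f : C(S, ℝ) | 0 ≤ f x}) ∩
      ⋂ x, ⋂ y, {f : C(S, ℝ) | f y ≤ f x * Real.exp (M * dist x y)} := by
    ext f; simp [logLipCone]
  rw [this]
  refine (isClosed_iInter fun x => isClosed_le continuous_const
    (ContinuousEvalConst.continuous_eval_const x)).inter
    (isClosed_iInter fun x => isClosed_iInter fun y => isClosed_le
      (ContinuousEvalConst.continuous_eval_const y)
      ((ContinuousEvalConst.continuous_eval_const x).mul continuous_const))

theorem exp_sub_one_le_mul_exp {t : ℝ} : Real.exp t - 1 ≤ t * Real.exp t := by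
  have h := Real.add_one_le_exp (-t)
  have h2 : Real.exp (-t) * Real.exp t = 1 := by rw [← Real.exp_add]; simp
  nlinarith [Real.exp_pos t]

variable [CompactSpace S]

theorem dist_le_diam_univ (x y : S) : dist x y ≤ Metric.diam (Set.univ : Set S) :=
  Metric.dist_le_diam_of_mem isCompact_univ.isBounded (Set.mem_univ x) (Set.mem_univ y)

theorem le_mul_exp_diam {M : ℝ} (hM : 0 ≤ M) {f : C(S, ℝ)} (hf : f ∈ logLipCone S M) (x y : S) :
    f y ≤ f x * Real.exp (M * Metric.diam (Set.univ : Set S)) :=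
  (hf.2 x y).trans (mul_le_mul_of_nonneg_left (Real.exp_le_exp.2
    (mul_le_mul_of_nonneg_left (dist_le_diam_univ x y) hM)) (hf.1 x))

theorem norm_le_mul_exp_diam {M : ℝ} (hM : 0 ≤ M) {f : C(S, ℝ)} (hf : f ∈ logLipCone S M)
    (x : S) : ‖f‖ ≤ f x * Real.exp (M * Metric.diam (Set.univ : Set S)) := by
  refine (ContinuousMap.norm_le _ (mul_nonneg (hf.1 x) (Real.exp_pos _).le)).2 fun y => ?_
  rw [Real.norm_of_nonneg (hf.1 y)]
  exact le_mul_exp_diam hM hf x y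

/-- The cone inequality and the bound `C` give a common Lipschitz constant, so Arzelà–Ascoli
applies. The same constant shows that pointwise solutions of the inequalities are automatically
continuous, whence the image in the product space is closed. -/
theorem isCompact_logLipCone_inter_closedBall {M : ℝ} (hM : 0 ≤ M) (C : ℝ) :
    IsCompact {f : C(S, ℝ) | f ∈ logLipCone S M ∧ ∀ x, f x ≤ C} := by
  set D := Metric.diam (Set.univ : Set S)
  set K : NNReal := (C * (M * Real.exp (M * D))).toNNReal with hK
  have lip : ∀ g : S → ℝ, (∀ x, 0 ≤ g x) → (∀ x, g x ≤ C) →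
      (∀ x y, g y ≤ g x * Real.exp (M * dist x y)) → LipschitzWith K g := by
    intro g h0 hC hg
    refine LipschitzWith.of_le_add_mul K fun y x => ?_
    have h1 : Real.exp (M * dist x y) - 1 ≤ M * Real.exp (M * D) * dist x y := by
      refine exp_sub_one_le_mul_exp.trans ?_
      rw [mul_right_comm]
      have := dist_le_diam_univ x y
      gcongr
    have h2 : g x * (Real.exp (M * dist x y) - 1) ≤ C * (M * Real.exp (M * D) * dist x y) :=
      mul_le_mul (hC x) h1 (by simpa using mul_nonneg hM dist_nonneg) ((h0 x).trans (hC x))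
    have h3 : C * (M * Real.exp (M * D)) * dist x y ≤ K * dist y x := by
      rw [dist_comm y x]
      exact mul_le_mul_of_nonneg_right (Real.le_coe_toNNReal _) dist_nonneg
    nlinarith [hg x y]
  refine ArzelaAscoli.isCompact_of_equicontinuous _ ?_ ?_
  · have himg : ContinuousMap.toFun '' {f : C(S, ℝ) | f ∈ logLipCone S M ∧ ∀ x, f x ≤ C} =
        (Set.univ.pi fun _ => Set.Icc 0 C) ∩
          ⋂ x, ⋂ y, {g : S → ℝ | g y ≤ g x * Real.exp (M * dist x y)} := by
      ext g
      constructor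
      · rintro ⟨f, hf, rfl⟩
        exact ⟨fun x _ => ⟨hf.1.1 x, hf.2 x⟩,
          Set.mem_iInter.2 fun x => Set.mem_iInter.2 fun y => hf.1.2 x y⟩
      · rintro ⟨h1, h2⟩
        simp only [Set.mem_iInter, Set.mem_ofPred_eq] at h2
        have h1' : ∀ x, 0 ≤ g x ∧ g x ≤ C := fun x => h1 x (Set.mem_univ x)
        exact ⟨⟨g, (lip g (fun x => (h1' x).1) (fun x => (h1' x).2) h2).continuous⟩,
          ⟨⟨fun x => (h1' x).1, h2⟩, fun x => (h1' x).2⟩, rfl⟩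
    rw [himg]
    refine (isCompact_univ_pi fun _ => isCompact_Icc).inter_right ?_
    exact isClosed_iInter fun x => isClosed_iInter fun y => isClosed_le
      (continuous_apply y) ((continuous_apply x).mul continuous_const)
  · refine (LipschitzWith.uniformEquicontinuous _ K fun f => ?_).equicontinuous
    exact lip _ f.2.1.1 f.2.2 f.2.1.2

end Cone

/-- A two-sided Fekete lemma: `log a` is subadditive and `log a - log C` is superadditive, and
comparison at the common index `(m + 1) * (n + 1)` separates their slopes; `log R` is the supremum
of the lower ones. -/
theorem exists_pow_le_le_mul_pow {a : ℕ → ℝ} {C : ℝ} (hC : 1 ≤ C) (ha : ∀ n, 0 < a n)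
    (h0 : a 0 = 1) (hsub : ∀ m n, a (m + n) ≤ a m * a n)
    (hsup : ∀ m n, a m * a n ≤ C * a (m + n)) :
    ∃ R : ℝ, 0 < R ∧ ∀ n, R ^ n ≤ a n ∧ a n ≤ C * R ^ n := by
  have hC0 : 0 < C := zero_lt_one.trans_le hC
  have hc0 : 0 ≤ Real.log C := Real.log_nonneg hC
  have usub : ∀ m n, Real.log (a (m + n)) ≤ Real.log (a m) + Real.log (a n) := fun m n => by
    rw [← Real.log_mul (ha m).ne' (ha n).ne']
    exact Real.log_le_log (ha _) (hsub m n)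
  have usup : ∀ m n, Real.log (a m) + Real.log (a n) ≤ Real.log C + Real.log (a (m + n)) :=
    fun m n => by
      rw [← Real.log_mul (ha m).ne' (ha n).ne', ← Real.log_mul hC0.ne' (ha _).ne']
      exact Real.log_le_log (mul_pos (ha m) (ha n)) (hsup m n)
  have h1 : ∀ m n : ℕ, Real.log (a (m * (n + 1))) ≤ (n + 1) * Real.log (a m) := fun m n => by
    induction n with
    | zero => simp
    | succ n ih =>
      rw [mul_add_one m (n + 1)]
      push_cast
      linarith [usub (m * (n + 1)) m]
  have h2 : ∀ m n : ℕ, (n + 1) * (Real.log (a m) - Real.log C) ≤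
      Real.log (a (m * (n + 1))) - Real.log C := fun m n => by
    induction n with
    | zero => simp
    | succ n ih =>
      rw [mul_add_one m (n + 1)]
      push_cast
      linarith [usup (m * (n + 1)) m]
  have h3 : ∀ m n : ℕ, (Real.log (a (m + 1)) - Real.log C) / (m + 1) ≤
      Real.log (a (n + 1)) / (n + 1) := fun m n => by
    rw [div_le_div_iff₀ (by positivity) (by positivity)]
    have e1 := h1 (n + 1) m
    have e2 := h2 (m + 1) n
    rw [mul_comm (n + 1) (m + 1)] at e1
    linarith
  set l : ℝ := ⨆ m : ℕ, (Real.log (a (m + 1)) - Real.log C) / (m + 1)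
  refine ⟨Real.exp l, Real.exp_pos _, fun n => ?_⟩
  rcases n with _ | n
  · simp [h0, hC]
  have hl1 : l ≤ Real.log (a (n + 1)) / (n + 1) := ciSup_le fun m => h3 m n
  have hl2 : (Real.log (a (n + 1)) - Real.log C) / (n + 1) ≤ l :=
    le_ciSup (f := fun m : ℕ => (Real.log (a (m + 1)) - Real.log C) / (m + 1))
      ⟨_, Set.forall_mem_range.2 fun m => h3 m 0⟩ n
  rw [le_div_iff₀ (by positivity)] at hl1
  rw [div_le_iff₀ (by positivity)] at hl2
  rw [← Real.exp_nat_mul, ← Real.log_le_log_iff (Real.exp_pos _) (ha _),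
    ← Real.log_le_log_iff (ha _) (by positivity), Real.log_mul hC0.ne' (Real.exp_pos _).ne',
    Real.log_exp]
  push_cast
  constructor <;> linarith

/-! ### Positive operators: growth rate and positive eigenvector. -/

section PositiveOperator

variable {S : Type*} [MetricSpace S]

/-- A positive operator on `C(S)`: it maps nonnegative functions to nonnegative functions. -/
def PreservesNonneg (T : C(S, ℝ) →L[ℝ] C(S, ℝ)) : Prop :=
  ∀ f : C(S, ℝ), (∀ x, 0 ≤ f x) → ∀ x, 0 ≤ T f x

variable {T : C(S, ℝ) →L[ℝ] C(S, ℝ)}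

theorem PreservesNonneg.mono (hT : PreservesNonneg T) {f g : C(S, ℝ)} (h : ∀ x, f x ≤ g x)
    (x : S) : T f x ≤ T g x := by
  have := hT (g - f) (fun x => sub_nonneg.2 (h x)) x
  rw [map_sub] at this
  exact sub_nonneg.1 this

variable [CompactSpace S]

theorem exists_pos_le [Nonempty S] {v : C(S, ℝ)} (hv : ∀ x, 0 < v x) :
    ∃ m, 0 < m ∧ ∀ x, m ≤ v x := by
  obtain ⟨x₀, -, hx₀⟩ := isCompact_univ.exists_isMinOn Set.univ_nonempty v.continuous.continuousOn
  exact ⟨v x₀, hv x₀, fun x => hx₀ (Set.mem_univ x)⟩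

theorem PreservesNonneg.pow (hT : PreservesNonneg T) (n : ℕ) : PreservesNonneg (T ^ n) := by
  induction n with
  | zero => exact fun f hf => hf
  | succ n ih => rw [pow_succ]; exact fun f hf => ih _ (hT f hf)

theorem pow_apply_eq_smul {T : C(S, ℝ) →L[ℝ] C(S, ℝ)} {v : C(S, ℝ)} {ρ : ℝ}
    (h : T v = ρ • v) (n : ℕ) : (T ^ n) v = ρ ^ n • v := by
  induction n with
  | zero => simp
  | succ n ih =>
    rw [pow_succ]
    change (T ^ n) (T v) = _
    rw [h, map_smul, ih, smul_smul, mul_comm, pow_succ]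

/-- Every `f` is squeezed between `±(‖f‖ / m) • v`, where `m` is a positive lower bound of `v`, and
positivity preserves the squeeze. -/
theorem PreservesNonneg.exists_norm_pow_le [Nonempty S] (hT : PreservesNonneg T) {v : C(S, ℝ)}
    (hv : ∀ x, 0 < v x) {ρ : ℝ} (hρ : 0 ≤ ρ) (h : T v = ρ • v) :
    ∃ C, 0 < C ∧ ∀ n f, ‖(T ^ n) f‖ ≤ C * ρ ^ n * ‖f‖ := by
  obtain ⟨m, hm, hmv⟩ := exists_pos_le hv
  have hvn : 0 < ‖v‖ := by
    obtain ⟨x⟩ := ‹Nonempty S›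
    exact ((hv x).trans_le (le_abs_self _)).trans_le (v.norm_coe_le_norm x)
  refine ⟨‖v‖ / m, by positivity, fun n f => ?_⟩
  refine (ContinuousMap.norm_le _ (by positivity)).2 fun x => ?_
  have hb : ∀ y, ‖f y‖ ≤ (‖f‖ / m) * v y := fun y => by
    refine (f.norm_coe_le_norm y).trans ?_
    rw [div_mul_eq_mul_div, le_div_iff₀ hm]
    exact mul_le_mul_of_nonneg_left (hmv y) (norm_nonneg f)
  have e : (T ^ n) ((‖f‖ / m) • v) x = ‖f‖ / m * (ρ ^ n * v x) := by
    rw [map_smul, pow_apply_eq_smul h]; rfl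
  have h1 := (hT.pow n).mono (f := f) (g := (‖f‖ / m) • v)
    (fun y => (le_abs_self _).trans (hb y)) x
  have h2 := (hT.pow n).mono (f := -f) (g := (‖f‖ / m) • v)
    (fun y => (neg_le_abs _).trans (hb y)) x
  rw [e] at h1 h2
  rw [map_neg, ContinuousMap.neg_apply] at h2
  have h3 : ‖f‖ / m * (ρ ^ n * v x) ≤ ‖f‖ / m * (ρ ^ n * ‖v‖) := by
    gcongr
    exact (le_abs_self _).trans (v.norm_coe_le_norm x)
  have h4 : ‖v‖ / m * ρ ^ n * ‖f‖ = ‖f‖ / m * (ρ ^ n * ‖v‖) := by ring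
  rw [h4, Real.norm_eq_abs]
  exact abs_le.2 ⟨by linarith, by linarith⟩

theorem pow_mem_logLipCone {M : ℝ} (hK : ∀ f ∈ logLipCone S M, T f ∈ logLipCone S M)
    {f : C(S, ℝ)} (hf : f ∈ logLipCone S M) (n : ℕ) : (T ^ n) f ∈ logLipCone S M := by
  induction n with
  | zero => exact hf
  | succ n ih => rw [pow_succ']; exact hK _ ih

/-- All `T ^ n 1` stay in the cone, so by Harnack each value is comparable to the norm; replacing `T
^ n 1` by a constant function then makes the norms almost multiplicative. -/
theorem exists_growth_rate [Nonempty S] (hT : PreservesNonneg T)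
    (hT' : ∀ f : C(S, ℝ), (∀ x, 0 < f x) → ∀ x, 0 < T f x) {M : ℝ} (hM : 0 ≤ M)
    (hK : ∀ f ∈ logLipCone S M, T f ∈ logLipCone S M) :
    ∃ C R : ℝ, 1 ≤ C ∧ 0 < R ∧ ∀ n x, R ^ n ≤ C * (T ^ n) 1 x ∧ (T ^ n) 1 x ≤ C * R ^ n := by
  set C := Real.exp (M * Metric.diam (Set.univ : Set S)) with hC
  have hC1 : 1 ≤ C := Real.one_le_exp (mul_nonneg hM Metric.diam_nonneg)
  obtain ⟨x₀⟩ := ‹Nonempty S›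
  have hpos : ∀ n x, 0 < (T ^ n) 1 x := fun n => by
    induction n with
    | zero => exact fun x => one_pos
    | succ n ih => rw [pow_succ']; exact hT' _ ih
  have hle : ∀ n x, (T ^ n) 1 x ≤ ‖(T ^ n) (1 : C(S, ℝ))‖ := fun n x =>
    (le_abs_self _).trans (((T ^ n) 1).norm_coe_le_norm x)
  have hge : ∀ n x, ‖(T ^ n) (1 : C(S, ℝ))‖ ≤ C * (T ^ n) 1 x := fun n x => by
    rw [mul_comm]
    exact norm_le_mul_exp_diam hM (pow_mem_logLipCone hK (one_mem_logLipCone hM) n) x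
  have hstep : ∀ m n x, (T ^ (m + n)) 1 x ≤ ‖(T ^ n) (1 : C(S, ℝ))‖ * (T ^ m) 1 x ∧
      ‖(T ^ n) (1 : C(S, ℝ))‖ * (T ^ m) 1 x ≤ C * (T ^ (m + n)) 1 x := fun m n x => by
    have h1 := (hT.pow m).mono (f := (T ^ n) 1) (g := ‖(T ^ n) (1 : C(S, ℝ))‖ • 1)
      (fun y => by simpa using hle n y) x
    have h2 := (hT.pow m).mono (f := ‖(T ^ n) (1 : C(S, ℝ))‖ • 1) (g := C • (T ^ n) 1)
      (fun y => by simpa using hge n y) x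
    rw [map_smul] at h1 h2
    rw [map_smul] at h2
    rw [pow_add]
    exact ⟨h1, h2⟩
  have ha : ∀ n, 0 < ‖(T ^ n) (1 : C(S, ℝ))‖ := fun n => (hpos n x₀).trans_le (hle n x₀)
  obtain ⟨R, hR, hRa⟩ := exists_pow_le_le_mul_pow (a := fun n => ‖(T ^ n) (1 : C(S, ℝ))‖) hC1 ha
    (by
      have : Nonempty S := ⟨x₀⟩
      simp)
    (fun m n => by
      refine (ContinuousMap.norm_le _ (mul_pos (ha m) (ha n)).le).2 fun x => ?_
      rw [Real.norm_of_nonneg (hpos _ x).le, mul_comm]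
      exact (hstep m n x).1.trans (mul_le_mul_of_nonneg_left (hle m x) (ha n).le))
    (fun m n => by
      rw [← le_div_iff₀ (ha n)]
      refine (ContinuousMap.norm_le _
        (div_nonneg (mul_nonneg (zero_le_one.trans hC1) (norm_nonneg _)) (ha n).le)).2 fun x => ?_
      rw [Real.norm_of_nonneg (hpos _ x).le, le_div_iff₀ (ha n), mul_comm]
      exact (hstep m n x).2.trans
        (mul_le_mul_of_nonneg_left (hle _ x) (zero_le_one.trans hC1)))
  exact ⟨C, R, hC1, hR, fun n x =>
    ⟨(hRa n).1.trans (hge n x), (hle n x).trans (hRa n).2⟩⟩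

/-- A positive operator leaving the cone `K(M; S)` invariant has a positive eigenvector, which
lies in every invariant cone. -/
theorem exists_pos_eigenvector [Nonempty S] (hT : PreservesNonneg T)
    (hT' : ∀ f : C(S, ℝ), (∀ x, 0 < f x) → ∀ x, 0 < T f x) {M : ℝ} (hM : 0 ≤ M)
    (hK : ∀ f ∈ logLipCone S M, T f ∈ logLipCone S M) :
    ∃ (R : ℝ) (w : C(S, ℝ)), 0 < R ∧ (∀ x, 0 < w x) ∧ T w = R • w ∧
      ∀ N : ℝ, 0 ≤ N → (∀ f ∈ logLipCone S N, T f ∈ logLipCone S N) → w ∈ logLipCone S N := by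
  obtain ⟨C, R, hC, hR, hCR⟩ := exists_growth_rate hT hT' hM hK
  have hC0 : 0 < C := zero_lt_one.trans_le hC
  set a : ℕ → C(S, ℝ) := fun n => (R ^ n)⁻¹ • (T ^ n) 1 with ha
  have ha_le : ∀ n x, a n x ≤ C := fun n x => by
    change (R ^ n)⁻¹ * (T ^ n) 1 x ≤ C
    rw [inv_mul_le_iff₀ (pow_pos hR n), mul_comm]
    exact (hCR n x).2
  have ha_ge : ∀ n x, C⁻¹ ≤ a n x := fun n x => by
    change C⁻¹ ≤ (R ^ n)⁻¹ * (T ^ n) 1 x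
    rw [inv_le_iff_one_le_mul₀ hC0, mul_assoc, le_inv_mul_iff₀ (pow_pos hR n), mul_one, mul_comm]
    exact (hCR n x).1
  have ha_mem : ∀ N : ℝ, 0 ≤ N → (∀ f ∈ logLipCone S N, T f ∈ logLipCone S N) →
      ∀ n, a n ∈ logLipCone S N := fun N hN h n =>
    logLipCone_smul_mem (pow_mem_logLipCone h (one_mem_logLipCone hN) n)
      (inv_nonneg.2 (pow_nonneg hR.le n))
  have haT : ∀ n, T (a n) = R • a (n + 1) := fun n => by
    simp only [ha, map_smul, smul_smul, pow_succ']
    rw [mul_inv, mul_inv_cancel_left₀ hR.ne']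
    rfl
  -- Averaging makes `T w - R • w` telescope to a bounded function divided by `n + 1`, while the
  -- bounds `C⁻¹` and `C` persist and keep the limit positive.
  set w : ℕ → C(S, ℝ) := fun n => ((n : ℝ) + 1)⁻¹ • ∑ i ∈ Finset.range (n + 1), a i with hw
  have hwx : ∀ n x, w n x = ((n : ℝ) + 1)⁻¹ * ∑ i ∈ Finset.range (n + 1), a i x := fun n x => by
    simp [hw]
  have hw_le : ∀ n x, w n x ≤ C := fun n x => by
    rw [hwx, inv_mul_le_iff₀ (by positivity)]
    refine (Finset.sum_le_sum fun i _ => ha_le i x).trans (le_of_eq ?_)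
    simp
  have hw_ge : ∀ n x, C⁻¹ ≤ w n x := fun n x => by
    rw [hwx, le_inv_mul_iff₀ (by positivity)]
    refine le_trans (le_of_eq ?_) (Finset.sum_le_sum fun i _ => ha_ge i x)
    simp
  have hw_mem : ∀ N : ℝ, 0 ≤ N → (∀ f ∈ logLipCone S N, T f ∈ logLipCone S N) →
      ∀ n, w n ∈ logLipCone S N := fun N hN h n =>
    logLipCone_smul_mem (logLipCone_sum_mem _ (ha_mem N hN h)) (by positivity)
  have hwT : ∀ n, T (w n) - R • w n = (R * ((n : ℝ) + 1)⁻¹) • (a (n + 1) - a 0) := fun n => by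
    have e : ∑ i ∈ Finset.range (n + 1), a (i + 1) - ∑ i ∈ Finset.range (n + 1), a i =
        a (n + 1) - a 0 := by
      rw [← Finset.sum_sub_distrib, Finset.sum_range_sub]
    rw [← e]
    simp only [hw, map_smul, map_sum, haT, ← Finset.smul_sum, smul_sub, smul_smul]
    rw [mul_comm]
  obtain ⟨w₀, hw₀, φ, hφ, hlim⟩ := (isCompact_logLipCone_inter_closedBall (S := S) hM C).tendsto_subseq
    (x := w) fun n => ⟨hw_mem M hM hK n, hw_le n⟩
  refine ⟨R, w₀, hR, fun x => ?_, ?_, fun N hN h => ?_⟩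
  · have := ((ContinuousEvalConst.continuous_eval_const (F := C(S, ℝ)) x).tendsto w₀).comp hlim
    exact (inv_pos.2 hC0).trans_le (ge_of_tendsto' this fun n => hw_ge _ x)
  · have hd : Tendsto (fun n => T (w n) - R • w n) atTop (𝓝 0) := by
      have hn : ∀ n, ‖T (w n) - R • w n‖ ≤ (1 / ((n : ℝ) + 1)) * (R * C) := fun n => by
        rw [hwT, norm_smul, Real.norm_of_nonneg (by positivity), one_div, mul_comm R, mul_assoc]
        gcongr
        refine (ContinuousMap.norm_le _ hC0.le).2 fun x => ?_
        have h0 := ha_ge 0 x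
        have h1 := ha_ge (n + 1) x
        have := inv_pos.2 hC0
        rw [ContinuousMap.sub_apply, Real.norm_eq_abs]
        exact abs_le.2 ⟨by linarith [ha_le 0 x], by linarith [ha_le (n + 1) x]⟩
      refine squeeze_zero_norm hn ?_
      simpa using tendsto_one_div_add_atTop_nhds_zero_nat.mul_const (R * C)
    have h1 : Tendsto (fun n => T (w (φ n)) - R • w (φ n)) atTop (𝓝 (T w₀ - R • w₀)) :=
      ((T.continuous.tendsto w₀).comp hlim).sub (hlim.const_smul R)
    exact sub_eq_zero.1 (tendsto_nhds_unique h1 (hd.comp hφ.tendsto_atTop))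
  · exact (isClosed_logLipCone N).mem_of_tendsto hlim
      (Eventually.of_forall fun n => hw_mem N hN h _)

end PositiveOperator

/-- The approximation is the infimal convolution of `f` with `K * dist`. The slope `K = 2 * ‖f‖ / δ`
makes the penalty beyond distance `δ` exceed any drop of `f`. -/
theorem exists_lipschitzWith_near {S : Type*} [MetricSpace S] [CompactSpace S] (f : C(S, ℝ))
    {ε : ℝ} (hε : 0 < ε) :
    ∃ (K : NNReal) (g : C(S, ℝ)), LipschitzWith K g ∧ ‖f - g‖ ≤ ε := by
  have huc := CompactSpace.uniformContinuous_of_continuous f.continuous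
  obtain ⟨δ, hδ, hf⟩ := Metric.uniformContinuous_iff.1 huc ε hε
  set K : NNReal := ⟨2 * ‖f‖ / δ, by positivity⟩ with hK
  have hKδ : (K : ℝ) * δ = 2 * ‖f‖ := div_mul_cancel₀ _ hδ.ne'
  have hfn : ∀ x, |f x| ≤ ‖f‖ := f.norm_coe_le_norm
  have hlow : ∀ x y, f x - ε ≤ f y + K * dist x y := fun x y => by
    rcases lt_or_ge (dist x y) δ with h | h
    · have h1 := hf h
      rw [Real.dist_eq] at h1
      have : 0 ≤ (K : ℝ) * dist x y := by positivity
      linarith [le_abs_self (f x - f y)]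
    · have : (K : ℝ) * δ ≤ K * dist x y := by gcongr
      linarith [(abs_le.1 (hfn x)).2, (abs_le.1 (hfn y)).1]
  have hbdd : ∀ x, BddBelow (Set.range fun y => f y + K * dist x y) := fun x =>
    ⟨f x - ε, Set.forall_mem_range.2 fun y => hlow x y⟩
  set g : S → ℝ := fun x => ⨅ y, (f y + K * dist x y) with hg
  have hgl : LipschitzWith K g := by
    refine LipschitzWith.of_le_add_mul K fun x x' => ?_
    have : Nonempty S := ⟨x⟩
    rw [← sub_le_iff_le_add]
    refine le_ciInf fun y => ?_
    have h1 := ciInf_le (hbdd x) y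
    have h2 : (K : ℝ) * dist x y ≤ K * (dist x x' + dist x' y) := by
      gcongr
      exact dist_triangle _ _ _
    change g x ≤ _ at h1
    linarith
  refine ⟨K, ⟨g, hgl.continuous⟩, hgl, (ContinuousMap.norm_le _ hε.le).2 fun x => ?_⟩
  have : Nonempty S := ⟨x⟩
  have h1 : f x - ε ≤ g x := le_ciInf fun y => hlow x y
  have h2 : g x ≤ f x := by simpa using ciInf_le (hbdd x) x
  change |f x - g x| ≤ ε
  exact abs_le.2 ⟨by linarith, by linarith⟩

/-! ### Convergence of the normalized powers to the line of the eigenvector. -/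

section Contraction

variable {S : Type*} [MetricSpace S] [CompactSpace S]

/-- Passing from `M'` to `M` leaves a slack of order `(M - M') * d` in the cone inequality at
distance `d`; subtracting `η * t * w` uses at most `η * c * d` of it. The choice `η = (M - M') / c`
depends on neither `g` nor `w`. -/
theorem exists_sub_smul_mem_logLipCone {M' M : ℝ} (hM' : 0 ≤ M') (hM : M' < M) :
    ∃ η : ℝ, 0 < η ∧ ∀ (g w : C(S, ℝ)) (t : ℝ), g ∈ logLipCone S M' → w ∈ logLipCone S M' →
      0 ≤ t → (∀ x, t * w x ≤ g x) → g - (η * t) • w ∈ logLipCone S M := by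
  set D := Metric.diam (Set.univ : Set S)
  have hM0 : 0 < M := hM'.trans_lt hM
  set c := (M + M') * Real.exp (M * D) with hc
  have hc0 : 0 < c := by positivity
  have hη1 : (M - M') / c ≤ 1 := by
    rw [div_le_one hc0]
    have : 1 ≤ Real.exp (M * D) := Real.one_le_exp (mul_nonneg hM0.le Metric.diam_nonneg)
    nlinarith
  refine ⟨(M - M') / c, div_pos (sub_pos.2 hM) hc0, fun g w t hg hw ht htg => ?_⟩
  set η := (M - M') / c with hη
  have hη0 : 0 ≤ η := (div_pos (sub_pos.2 hM) hc0).le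
  have hηt : ∀ x, η * t * w x ≤ g x := fun x => by
    rw [mul_assoc]
    exact (mul_le_of_le_one_left (mul_nonneg ht (hw.1 x)) hη1).trans (htg x)
  refine ⟨fun x => sub_nonneg.2 (hηt x), fun x y => ?_⟩
  change g y - η * t * w y ≤ (g x - η * t * w x) * Real.exp (M * dist x y)
  set d := dist x y with hd
  have hd0 : 0 ≤ d := dist_nonneg
  have h1 : g y ≤ g x * Real.exp (M' * d) := hg.2 x y
  have h2 : w x * Real.exp (-(M' * d)) ≤ w y := by
    rw [Real.exp_neg, mul_inv_le_iff₀ (Real.exp_pos _), hd, dist_comm]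
    exact hw.2 y x
  have h3 : (M - M') * d ≤ Real.exp (M * d) - Real.exp (M' * d) := by
    have e : Real.exp (M * d) = Real.exp (M' * d) * Real.exp ((M - M') * d) := by
      rw [← Real.exp_add]; ring_nf
    have e1 := Real.add_one_le_exp ((M - M') * d)
    have e2 : 1 ≤ Real.exp (M' * d) := Real.one_le_exp (by positivity)
    have e3 : 0 ≤ (M - M') * d := mul_nonneg (sub_pos.2 hM).le hd0
    nlinarith
  have h4 : Real.exp (M * d) - Real.exp (-(M' * d)) ≤ c * d := by
    have e : Real.exp (M * d) = Real.exp (-(M' * d)) * Real.exp ((M + M') * d) := by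
      rw [← Real.exp_add]; ring_nf
    have e1 := exp_sub_one_le_mul_exp (t := (M + M') * d)
    have e2 : Real.exp (M * d) ≤ Real.exp (M * D) :=
      Real.exp_le_exp.2 (mul_le_mul_of_nonneg_left (dist_le_diam_univ x y) hM0.le)
    calc Real.exp (M * d) - Real.exp (-(M' * d))
        = Real.exp (-(M' * d)) * (Real.exp ((M + M') * d) - 1) := by rw [e]; ring
      _ ≤ Real.exp (-(M' * d)) * ((M + M') * d * Real.exp ((M + M') * d)) := by gcongr
      _ = (M + M') * d * Real.exp (M * d) := by rw [e]; ring
      _ ≤ (M + M') * d * Real.exp (M * D) := by gcongr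
      _ = c * d := by rw [hc]; ring
  have h5 : η * (Real.exp (M * d) - Real.exp (-(M' * d))) ≤
      Real.exp (M * d) - Real.exp (M' * d) := by
    refine (mul_le_mul_of_nonneg_left h4 hη0).trans (le_trans (le_of_eq ?_) h3)
    rw [← mul_assoc, hη, div_mul_cancel₀ _ hc0.ne']
  have h6 : 0 ≤ Real.exp (M * d) - Real.exp (M' * d) :=
    (mul_nonneg (sub_pos.2 hM).le hd0).trans h3
  have h7 : t * w x * (Real.exp (M * d) - Real.exp (M' * d)) ≤
      g x * (Real.exp (M * d) - Real.exp (M' * d)) := mul_le_mul_of_nonneg_right (htg x) h6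
  have h8 := mul_le_mul_of_nonneg_left h5 (mul_nonneg ht (hw.1 x))
  have h9 := mul_le_mul_of_nonneg_left h2 (mul_nonneg hη0 ht)
  linarith

variable {Q : C(S, ℝ) →L[ℝ] C(S, ℝ)} {w : C(S, ℝ)} {M' M : ℝ}

theorem exists_contraction (hQ : PreservesNonneg Q) (hw : Q w = w) (hM' : 0 ≤ M') (hM : M' < M)
    (hwM : w ∈ logLipCone S M') (hK : ∀ f ∈ logLipCone S M, Q f ∈ logLipCone S M') :
    ∃ q : ℝ, 0 ≤ q ∧ q < 1 ∧ ∀ f ∈ logLipCone S M, ∀ s : ℝ, 0 ≤ s → (∀ x, f x ≤ s * w x) →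
      ∃ t : ℝ, Q f - t • w ∈ logLipCone S M ∧ ∀ x, (Q f - t • w) x ≤ q * s * w x := by
  obtain ⟨η, hη, hsub⟩ := exists_sub_smul_mem_logLipCone (S := S) hM' hM
  set C := Real.exp (M' * Metric.diam (Set.univ : Set S)) with hC
  have hC0 : 0 < C := Real.exp_pos _
  set κ := η * ((2 * (C * C))⁻¹) with hκ
  have hκ0 : 0 < κ := by positivity
  -- Either `Q f` is already below `(s / 2) w`, or it exceeds this at one point and Harnack bounds
  -- it below everywhere by a multiple of `s * w`, of which a fraction is removed.
  refine ⟨max (1 / 2) (1 - κ), le_max_of_le_left (by norm_num), max_lt (by norm_num) (by linarith),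
    fun f hf s hs hfs => ?_⟩
  have hQf := hK f hf
  by_cases h : ∀ x, Q f x ≤ 1 / 2 * s * w x
  · refine ⟨0, ?_, fun x => ?_⟩
    · rw [zero_smul, sub_zero]; exact logLipCone_mono hM.le hQf
    · rw [zero_smul, sub_zero]
      refine (h x).trans ?_
      have := hwM.1 x
      gcongr
      exact le_max_left _ _
  · push Not at h
    obtain ⟨x₀, hx₀⟩ := h
    have hlow : ∀ y, (2 * (C * C))⁻¹ * s * w y ≤ Q f y := fun y => by
      have h1 := le_mul_exp_diam hM' hQf y x₀
      have h2 := le_mul_exp_diam hM' hwM x₀ y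
      have h3 : s * w y ≤ s * (w x₀ * C) := mul_le_mul_of_nonneg_left h2 hs
      have h4 : 1 / 2 * s * w x₀ * C ≤ Q f y * C * C :=
        mul_le_mul_of_nonneg_right (hx₀.le.trans h1) hC0.le
      rw [mul_assoc, inv_mul_le_iff₀ (by positivity)]
      linarith
    refine ⟨η * ((2 * (C * C))⁻¹ * s), hsub _ _ _ hQf hwM (by positivity) hlow, fun x => ?_⟩
    have h1 : Q f x ≤ s * w x := by
      have := hQ.mono (f := f) (g := s • w) hfs x
      rwa [map_smul, hw] at this
    have h2 : (1 - κ) * s * w x ≤ max (1 / 2) (1 - κ) * s * w x := by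
      have := hwM.1 x
      gcongr
      exact le_max_right _ _
    refine le_trans (le_of_eq_of_le ?_ (sub_le_sub_right h1 (κ * s * w x))) (le_of_eq_of_le ?_ h2)
    · simp [hκ, mul_assoc]
    · ring

/-- Since `w` is fixed by `Q`, the multiples removed in successive contractions add up to a single
coefficient, and the remainder is bounded by `q ^ n * s * w`. -/
theorem eventually_near_span_of_mem (hQ : PreservesNonneg Q) (hw : Q w = w) (hM' : 0 ≤ M')
    (hM : M' < M) (hwM : w ∈ logLipCone S M')
    (hK : ∀ f ∈ logLipCone S M, Q f ∈ logLipCone S M') (hwpos : ∀ x, 0 < w x)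
    {f : C(S, ℝ)} (hf : f ∈ logLipCone S M) {ε : ℝ} (hε : 0 < ε) :
    ∀ᶠ n in atTop, ∃ t : ℝ, ‖(Q ^ n) f - t • w‖ ≤ ε := by
  rcases isEmpty_or_nonempty S with hS | hS
  · exact Eventually.of_forall fun n => ⟨0, (ContinuousMap.norm_le _ hε.le).2 fun x => hS.elim x⟩
  obtain ⟨q, hq0, hq1, hq⟩ := exists_contraction hQ hw hM' hM hwM hK
  obtain ⟨m, hm, hmw⟩ := exists_pos_le hwpos
  set s := ‖f‖ / m with hs
  have hs0 : 0 ≤ s := by positivity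
  have key : ∀ n, ∃ t : ℝ, (Q ^ n) f - t • w ∈ logLipCone S M ∧
      ∀ x, ((Q ^ n) f - t • w) x ≤ q ^ n * s * w x := fun n => by
    induction n with
    | zero =>
      refine ⟨0, by simpa using hf, fun x => ?_⟩
      simp only [pow_zero, one_mul, zero_smul, sub_zero]
      refine ((le_abs_self _).trans (f.norm_coe_le_norm x)).trans ?_
      rw [hs, div_mul_eq_mul_div, le_div_iff₀ hm]
      exact mul_le_mul_of_nonneg_left (hmw x) (norm_nonneg f)
    | succ n ih =>
      obtain ⟨t, ht, hts⟩ := ih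
      obtain ⟨t', ht', hts'⟩ := hq _ ht (q ^ n * s) (by positivity) hts
      have e : Q ((Q ^ n) f - t • w) - t' • w = (Q ^ (n + 1)) f - (t + t') • w := by
        rw [map_sub, map_smul, hw, add_smul, sub_sub, pow_succ']; rfl
      rw [e] at ht' hts'
      exact ⟨t + t', ht', fun x => by rw [pow_succ' q, mul_assoc q]; exact hts' x⟩
  have hlim : Tendsto (fun n => q ^ n * s * ‖w‖) atTop (𝓝 0) := by
    simpa using ((tendsto_pow_atTop_nhds_zero_of_lt_one hq0 hq1).mul_const s).mul_const ‖w‖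
  filter_upwards [hlim.eventually_le_const hε] with n hn
  obtain ⟨t, ht, hts⟩ := key n
  refine ⟨t, (ContinuousMap.norm_le _ hε.le).2 fun x => ?_⟩
  rw [Real.norm_of_nonneg (ht.1 x)]
  refine ((hts x).trans ?_).trans hn
  gcongr
  exact (le_abs_self _).trans (w.norm_coe_le_norm x)

theorem eventually_near_span (hQ : PreservesNonneg Q) (hw : Q w = w) (hM' : 0 ≤ M')
    (hM : M' < M) (hwM : w ∈ logLipCone S M')
    (hK : ∀ f ∈ logLipCone S M, Q f ∈ logLipCone S M') (hwpos : ∀ x, 0 < w x)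
    (f : C(S, ℝ)) {ε : ℝ} (hε : 0 < ε) :
    ∀ᶠ n in atTop, ∃ t : ℝ, ‖(Q ^ n) f - t • w‖ ≤ ε := by
  rcases isEmpty_or_nonempty S with hS | hS
  · exact Eventually.of_forall fun n => ⟨0, (ContinuousMap.norm_le _ hε.le).2 fun x => hS.elim x⟩
  obtain ⟨C, hC, hCQ⟩ := hQ.exists_norm_pow_le hwpos zero_le_one (by rw [hw, one_smul])
  obtain ⟨K, g, hg, hfg⟩ := exists_lipschitzWith_near f (ε := ε / (3 * C)) (by positivity)
  have hM0 : 0 < M := hM'.trans_lt hM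
  -- With this shift `g + c ≥ K / M`, so a `K`-Lipschitz increment is at most `M * d` relative to
  -- the value: `g` is a difference of two cone elements.
  set c := ‖g‖ + K / M with hc
  have hc0 : 0 ≤ c := by positivity
  have hgn : ∀ x, |g x| ≤ ‖g‖ := g.norm_coe_le_norm
  have hKM : 0 ≤ (K : ℝ) / M := by positivity
  have hgc : g + c • 1 ∈ logLipCone S M := by
    have hge : ∀ x, (K : ℝ) / M ≤ g x + c := fun x => by linarith [(abs_le.1 (hgn x)).1]
    have e : ∀ x, (g + c • (1 : C(S, ℝ))) x = g x + c := fun x => by simp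
    refine ⟨fun x => by rw [e]; exact hKM.trans (hge x), fun x y => ?_⟩
    rw [e, e]
    have h1 := hg.dist_le_mul y x
    rw [Real.dist_eq, dist_comm] at h1
    have h2 : g x + c + (g x + c) * (M * dist x y) ≤ (g x + c) * Real.exp (M * dist x y) := by
      have := mul_le_mul_of_nonneg_left (Real.add_one_le_exp (M * dist x y)) (hKM.trans (hge x))
      linarith
    have h3 : (K : ℝ) * dist x y ≤ (g x + c) * (M * dist x y) := by
      rw [← mul_assoc]
      exact mul_le_mul_of_nonneg_right ((div_le_iff₀ hM0).1 (hge x)) dist_nonneg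
    linarith [le_abs_self (g y - g x)]
  have hcm : c • (1 : C(S, ℝ)) ∈ logLipCone S M :=
    logLipCone_smul_mem (one_mem_logLipCone hM0.le) hc0
  have near := fun {h : C(S, ℝ)} (hh : h ∈ logLipCone S M) =>
    eventually_near_span_of_mem hQ hw hM' hM hwM hK hwpos hh (ε := ε / 3) (by positivity)
  filter_upwards [near hgc, near hcm] with n h1 h2
  obtain ⟨t₁, ht₁⟩ := h1
  obtain ⟨t₂, ht₂⟩ := h2
  refine ⟨t₁ - t₂, ?_⟩
  have h3 : ‖(Q ^ n) (f - g)‖ ≤ ε / 3 := by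
    refine (hCQ n _).trans ?_
    rw [one_pow, mul_one]
    refine (mul_le_mul_of_nonneg_left hfg hC.le).trans (le_of_eq ?_)
    field_simp
  have e : (Q ^ n) f - (t₁ - t₂) • w = (Q ^ n) (f - g) +
      (((Q ^ n) (g + c • 1) - t₁ • w) - ((Q ^ n) (c • 1) - t₂ • w)) := by
    rw [map_sub, map_add, sub_smul]; abel
  rw [e]
  refine (norm_add_le _ _).trans ?_
  have := norm_sub_le ((Q ^ n) (g + c • 1) - t₁ • w) ((Q ^ n) (c • 1) - t₂ • w)
  linarith

end Contraction

theorem mem_span_singleton_of_forall_near {𝕜 F : Type*} [NontriviallyNormedField 𝕜]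
    [CompleteSpace 𝕜] [NormedAddCommGroup F] [NormedSpace 𝕜 F] {f w : F}
    (h : ∀ ε : ℝ, 0 < ε → ∃ t : 𝕜, ‖f - t • w‖ ≤ ε) : f ∈ Submodule.span 𝕜 {w} := by
  have hcl : IsClosed (Submodule.span 𝕜 {w} : Set F) := Submodule.closed_of_finiteDimensional _
  rw [← SetLike.mem_coe, ← hcl.closure_eq, Metric.mem_closure_iff]
  intro ε hε
  obtain ⟨t, ht⟩ := h (ε / 2) (half_pos hε)
  refine ⟨t • w, Submodule.smul_mem _ _ (Submodule.mem_span_singleton_self w), ?_⟩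
  rw [dist_eq_norm]
  linarith

/-! ### Spectral radius, simplicity and the peripheral eigenvalues. -/

section Complexification

variable {S : Type*} [MetricSpace S]

/-- A real function regarded as a complex one. -/
def ofRealFun (v : C(S, ℝ)) : C(S, ℂ) := ⟨fun x => (v x : ℂ), by fun_prop⟩

theorem rePart_sub (f g : C(S, ℂ)) : rePart (f - g) = rePart f - rePart g := by
  ext x; simp [rePart]

theorem imPart_sub (f g : C(S, ℂ)) : imPart (f - g) = imPart f - imPart g := by
  ext x; simp [imPart]

theorem rePart_smul_ofRealFun (c : ℂ) (v : C(S, ℝ)) : rePart (c • ofRealFun v) = c.re • v := by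
  ext x; simp [rePart, ofRealFun]

theorem imPart_smul_ofRealFun (c : ℂ) (v : C(S, ℝ)) : imPart (c • ofRealFun v) = c.im • v := by
  ext x; simp [imPart, ofRealFun]

theorem ofRealFun_ne_zero [Nonempty S] {v : C(S, ℝ)} (hv : ∀ x, 0 < v x) : ofRealFun v ≠ 0 := by
  intro h
  obtain ⟨x⟩ := ‹Nonempty S›
  have := congrArg (fun g : C(S, ℂ) => g x) h
  simp [ofRealFun, (hv x).ne'] at this

variable [CompactSpace S]

theorem norm_le_norm_rePart_add_norm_imPart (f : C(S, ℂ)) : ‖f‖ ≤ ‖rePart f‖ + ‖imPart f‖ :=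
  (ContinuousMap.norm_le _ (by positivity)).2 fun x =>
    (Complex.norm_le_abs_re_add_abs_im (f x)).trans
      (add_le_add ((rePart f).norm_coe_le_norm x) ((imPart f).norm_coe_le_norm x))

variable {L : C(S, ℝ) →L[ℝ] C(S, ℝ)}

theorem rePart_complexification_pow (n : ℕ) (f : C(S, ℂ)) :
    rePart ((complexification L ^ n) f) = (L ^ n) (rePart f) := by
  induction n with
  | zero => rfl
  | succ n ih =>
    rw [pow_succ', pow_succ']
    change rePart (complexification L ((complexification L ^ n) f)) = L ((L ^ n) (rePart f))
    rw [← ih]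
    ext x
    simp [rePart, complexification_apply]

theorem imPart_complexification_pow (n : ℕ) (f : C(S, ℂ)) :
    imPart ((complexification L ^ n) f) = (L ^ n) (imPart f) := by
  induction n with
  | zero => rfl
  | succ n ih =>
    rw [pow_succ', pow_succ']
    change imPart (complexification L ((complexification L ^ n) f)) = L ((L ^ n) (imPart f))
    rw [← ih]
    ext x
    simp [imPart, complexification_apply]

theorem complexification_ofRealFun {v : C(S, ℝ)} {ρ : ℝ} (h : L v = ρ • v) :
    complexification L (ofRealFun v) = (ρ : ℂ) • ofRealFun v := by
  have h1 : rePart (ofRealFun v) = v := by ext x; simp [rePart, ofRealFun]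
  have h2 : imPart (ofRealFun v) = 0 := by ext x; simp [imPart, ofRealFun]
  ext x
  rw [complexification_apply, h1, h2, h]
  simp [ofRealFun]

theorem mem_spectrum_of_pos [Nonempty S] {v : C(S, ℝ)} (hv : ∀ x, 0 < v x) {ρ : ℝ}
    (h : L v = ρ • v) : (ρ : ℂ) ∈ spectrum ℂ (complexification L) := by
  rw [spectrum.mem_iff]
  rintro ⟨u, hu⟩
  have h0 : (u : C(S, ℂ) →L[ℂ] C(S, ℂ)) (ofRealFun v) = 0 := by
    rw [hu, sub_apply, complexification_ofRealFun h,
      ContinuousLinearMap.algebraMap_apply, sub_self]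
  apply ofRealFun_ne_zero hv
  calc ofRealFun v = (↑u⁻¹ * ↑u : C(S, ℂ) →L[ℂ] C(S, ℂ)) (ofRealFun v) := by
        rw [u.inv_mul]; rfl
    _ = 0 := by rw [mul_apply_eq_comp, h0, map_zero]

theorem norm_complexification_pow_le {C ρ : ℝ} (hC : 0 ≤ C) (hρ : 0 ≤ ρ)
    (hCL : ∀ n f, ‖(L ^ n) f‖ ≤ C * ρ ^ n * ‖f‖) (n : ℕ) :
    ‖complexification L ^ n‖ ≤ 2 * C * ρ ^ n := by
  refine ContinuousLinearMap.opNorm_le_bound _ (by positivity) fun f => ?_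
  refine (norm_le_norm_rePart_add_norm_imPart _).trans ?_
  rw [rePart_complexification_pow, imPart_complexification_pow]
  have h1 : C * ρ ^ n * ‖rePart f‖ ≤ C * ρ ^ n * ‖f‖ := by
    gcongr; exact norm_rePart_le f
  have h2 : C * ρ ^ n * ‖imPart f‖ ≤ C * ρ ^ n * ‖f‖ := by
    gcongr; exact norm_imPart_le f
  linarith [hCL n (rePart f), hCL n (imPart f)]

theorem norm_le_of_mem_spectrum_of_norm_pow_le {F : Type*} [NormedAddCommGroup F]
    [NormedSpace ℂ F] [CompleteSpace F] {a : F →L[ℂ] F} {C ρ : ℝ} (hρ : 0 < ρ) (h : ∀ n, ‖a ^ n‖ ≤ C * ρ ^ n) {z : ℂ}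
    (hz : z ∈ spectrum ℂ a) : ‖z‖ ≤ ρ := by
  by_contra! hlt
  have hr : 1 < ‖z‖ / ρ := (one_lt_div hρ).2 hlt
  obtain ⟨n, hn⟩ := pow_unbounded_of_one_lt (C * ‖(1 : F →L[ℂ] F)‖) hr
  have h1 := spectrum.norm_le_norm_mul_of_mem (spectrum.pow_mem_pow _ n hz)
  rw [div_pow, lt_div_iff₀ (pow_pos hρ n)] at hn
  have h2 := mul_le_mul_of_nonneg_right (h n) (norm_nonneg (1 : F →L[ℂ] F))
  rw [norm_pow] at h1
  linarith

theorem spectralRadius_eq_of_forall_le {A : Type*} [Ring A] [Algebra ℂ A] {a : A}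
    {ρ : ℝ} (hρ : 0 ≤ ρ) (hmem : (ρ : ℂ) ∈ spectrum ℂ a) (hle : ∀ z ∈ spectrum ℂ a, ‖z‖ ≤ ρ) :
    (spectralRadius ℂ a).toReal = ρ := by
  have heq : spectralRadius ℂ a = ENNReal.ofReal ρ := by
    refine le_antisymm (iSup₂_le fun z hz => ?_) ?_
    · rw [← enorm_eq_nnnorm, ← ofReal_norm]
      exact ENNReal.ofReal_le_ofReal (hle z hz)
    · refine le_of_eq_of_le ?_ (le_iSup₂ (ρ : ℂ) hmem)
      rw [← enorm_eq_nnnorm, ← ofReal_norm, Complex.norm_real, Real.norm_of_nonneg hρ]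
  rw [heq, ENNReal.toReal_ofReal hρ]

theorem specRadius_eq [Nonempty S] (hL : PreservesNonneg L) {v : C(S, ℝ)} (hv : ∀ x, 0 < v x)
    {ρ : ℝ} (hρ : 0 < ρ) (h : L v = ρ • v) : specRadius L = ρ := by
  obtain ⟨C, hC, hCL⟩ := hL.exists_norm_pow_le hv hρ.le h
  have h1 := norm_complexification_pow_le hC.le hρ.le hCL
  have h2 := mem_spectrum_of_pos hv h
  have h3 : ∀ z ∈ spectrum ℂ (complexification L), ‖z‖ ≤ ρ := fun z hz =>
    norm_le_of_mem_spectrum_of_norm_pow_le hρ h1 hz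
  rw [specRadius]
  exact spectralRadius_eq_of_forall_le hρ.le h2 h3

variable {v : C(S, ℝ)} {ρ : ℝ} {μ : ℕ}

/-- Iteration gives `z ^ n • f` plus a multiple of `v`. Because `‖z‖ = ρ`, division by `z ^ n` loses
nothing against the normalization by `ρ ^ n`, so `f` is arbitrarily close to the line. Taking `c =
0` treats eigenvectors, and `z = ρ` generalized ones. -/
theorem mem_span_of_complexification_eq (hρ : 0 < ρ) (h : L v = ρ • v)
    (hnear : ∀ (f : C(S, ℝ)) (ε : ℝ), 0 < ε →
      ∀ᶠ n in atTop, ∃ t : ℝ, ‖(((ρ ^ μ)⁻¹ • L ^ μ) ^ n) f - t • v‖ ≤ ε)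
    {f : C(S, ℂ)} {z c : ℂ} (hz : ‖z‖ = ρ)
    (hf : complexification L f = z • f + c • ofRealFun v) :
    f ∈ Submodule.span ℂ {ofRealFun v} := by
  set V := ofRealFun v
  have hpow : ∀ n : ℕ, ∃ d : ℂ, (complexification L ^ n) f = z ^ n • f + d • V := fun n => by
    induction n with
    | zero => exact ⟨0, by simp⟩
    | succ n ih =>
      obtain ⟨d, hd⟩ := ih
      refine ⟨z ^ n * c + d * ρ, ?_⟩
      rw [pow_succ']
      change complexification L ((complexification L ^ n) f) = _
      rw [hd, map_add, map_smul, map_smul, hf, complexification_ofRealFun h]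
      module
  refine mem_span_singleton_of_forall_near fun ε hε => ?_
  obtain ⟨n, ⟨t₁, ht₁⟩, t₂, ht₂⟩ := ((hnear (rePart f) (ε / 2) (half_pos hε)).and
    (hnear (imPart f) (ε / 2) (half_pos hε))).exists
  obtain ⟨d, hd⟩ := hpow (μ * n)
  have hρn : 0 < ρ ^ (μ * n) := pow_pos hρ _
  have hz0 : z ≠ 0 := norm_pos_iff.1 (hz ▸ hρ)
  have hzn : z ^ (μ * n) ≠ 0 := pow_ne_zero _ hz0
  have hQ : L ^ (μ * n) = ρ ^ (μ * n) • ((ρ ^ μ)⁻¹ • L ^ μ) ^ n := by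
    rw [smul_pow, smul_smul, inv_pow, ← pow_mul, ← pow_mul, mul_inv_cancel₀ hρn.ne', one_smul]
  have hreal : ∀ (g : C(S, ℝ)) (t : ℝ), ‖(((ρ ^ μ)⁻¹ • L ^ μ) ^ n) g - t • v‖ ≤ ε / 2 →
      ‖(L ^ (μ * n)) g - (ρ ^ (μ * n) * t) • v‖ ≤ ρ ^ (μ * n) * (ε / 2) := fun g t hg => by
    rw [hQ, smul_apply, mul_smul, ← smul_sub, norm_smul,
      Real.norm_of_nonneg hρn.le]
    gcongr
  set τ : ℂ := ⟨ρ ^ (μ * n) * t₁, ρ ^ (μ * n) * t₂⟩ with hτ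
  refine ⟨(z ^ (μ * n))⁻¹ * (τ - d), ?_⟩
  have e : f - ((z ^ (μ * n))⁻¹ * (τ - d)) • V =
      (z ^ (μ * n))⁻¹ • ((complexification L ^ (μ * n)) f - τ • V) := by
    have : f = (z ^ (μ * n))⁻¹ • (z ^ (μ * n) • f) := by
      rw [smul_smul, inv_mul_cancel₀ hzn, one_smul]
    rw [hd]
    nth_rewrite 1 [this]
    module
  rw [e, norm_smul, norm_inv, norm_pow, hz, inv_mul_le_iff₀ hρn]
  refine (norm_le_norm_rePart_add_norm_imPart _).trans ?_
  rw [rePart_sub, imPart_sub, rePart_complexification_pow, imPart_complexification_pow,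
    rePart_smul_ofRealFun, imPart_smul_ofRealFun]
  linarith [hreal _ _ ht₁, hreal _ _ ht₂]

theorem algMultiplicity_eq_one [Nonempty S] (hρ : 0 < ρ) (hv : ∀ x, 0 < v x) (h : L v = ρ • v)
    (hnear : ∀ (f : C(S, ℝ)) (ε : ℝ), 0 < ε →
      ∀ᶠ n in atTop, ∃ t : ℝ, ‖(((ρ ^ μ)⁻¹ • L ^ μ) ^ n) f - t • v‖ ≤ ε) :
    algMultiplicity L ρ = 1 := by
  have hspan : Module.End.maxGenEigenspace
      (complexification L : C(S, ℂ) →ₗ[ℂ] C(S, ℂ)) (ρ : ℂ) =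
      Submodule.span ℂ {ofRealFun v} := by
    refine le_antisymm (fun f hf => ?_) ?_
    · obtain ⟨k, hk⟩ := Module.End.mem_maxGenEigenspace _ _ _ |>.1 hf
      clear hf
      -- By induction, the image of `f` under the operator minus `ρ` is a multiple of `v`.
      induction k generalizing f with
      | zero => rw [show f = 0 from hk]; exact Submodule.zero_mem _
      | succ k ih =>
        rw [pow_succ] at hk
        obtain ⟨c, hc⟩ := Submodule.mem_span_singleton.1 (ih _ hk)
        refine mem_span_of_complexification_eq hρ h hnear (z := ρ) (c := c) ?_ ?_
        · rw [Complex.norm_real, Real.norm_of_nonneg hρ.le]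
        · rw [hc]
          simp
    · rw [Submodule.span_singleton_le_iff_mem, Module.End.mem_maxGenEigenspace]
      refine ⟨1, ?_⟩
      simp [complexification_ofRealFun h]
  rw [algMultiplicity, hspan, Module.rank_eq_one_iff_finrank_eq_one]
  exact finrank_span_singleton (ofRealFun_ne_zero hv)

theorem eq_of_isEigenvalue_of_norm_eq (hρ : 0 < ρ) (h : L v = ρ • v)
    (hnear : ∀ (f : C(S, ℝ)) (ε : ℝ), 0 < ε →
      ∀ᶠ n in atTop, ∃ t : ℝ, ‖(((ρ ^ μ)⁻¹ • L ^ μ) ^ n) f - t • v‖ ≤ ε)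
    {z : ℂ} (hz : IsEigenvalue L z) (hzρ : ‖z‖ = ρ) : z = ρ := by
  obtain ⟨f, hf, hf0⟩ := Module.End.HasEigenvalue.exists_hasEigenvector hz
  have hLf : complexification L f = z • f := Module.End.mem_eigenspace_iff.1 hf
  obtain ⟨c, rfl⟩ := Submodule.mem_span_singleton.1 <|
    mem_span_of_complexification_eq hρ h hnear (c := 0) hzρ (by simpa using hLf)
  rw [map_smul, complexification_ofRealFun h, smul_comm] at hLf
  exact (smul_left_injective ℂ hf0 hLf).symm

end Complexification

/-! ### Assembly for the transfer operator. -/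

section Main

variable {S B : Type*} [MetricSpace S] [CompactSpace S] [Nonempty S] [Nonempty B]
  {θ : B → C(S, S)} {b : B → C(S, ℝ)}

/-- The Perron–Frobenius theorem for a transfer operator, an iterate of which is given by
contractions and log-Lipschitz weights. -/
theorem transferOperator_perron (hpos : ∀ β x, 0 < b β x) (hsum : ∀ x, Summable fun β => b β x)
    (hcont : Continuous fun x => ∑' β, b β x) {μ : ℕ} {κ : NNReal} (hκ : κ < 1)
    (hcontr : ∀ ω : Fin μ → B, LipschitzWith κ (wordMap θ μ ω))
    (hcone : ∃ M₀ : ℝ, 0 < M₀ ∧ ∀ ω : Fin μ → B, wordWeight θ b μ ω ∈ logLipCone S M₀) :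
    let L := transferOperator θ b hpos hsum hcont
    0 < specRadius L ∧
    (∃ v : C(S, ℝ), (∀ x, 0 < v x) ∧ L v = specRadius L • v ∧
      ∀ M₀ : ℝ, 0 < M₀ → (∀ ω : Fin μ → B, wordWeight θ b μ ω ∈ logLipCone S M₀) →
        v ∈ logLipCone S (M₀ / (1 - (κ : ℝ)))) ∧
    algMultiplicity L (specRadius L) = 1 ∧
    ∀ z : ℂ, IsEigenvalue L z → ‖z‖ = specRadius L → z = specRadius L := by
  intro L
  have hκ1 : 0 < 1 - (κ : ℝ) := sub_pos.2 (by exact_mod_cast hκ)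
  have hL : PreservesNonneg L := fun f hf => transferOperator_nonneg hpos hsum hcont hf
  have hL' : ∀ f : C(S, ℝ), (∀ x, 0 < f x) → ∀ x, 0 < L f x := fun f hf =>
    transferOperator_pos hpos hsum hcont hf
  have hT' : ∀ f : C(S, ℝ), (∀ x, 0 < f x) → ∀ x, 0 < (L ^ μ) f x := by
    clear hcontr hcone
    induction μ with
    | zero => exact fun f hf => hf
    | succ n ih => rw [pow_succ]; exact fun f hf => ih _ (hL' f hf)
  have hinv : ∀ M₀ : ℝ, 0 < M₀ → (∀ ω : Fin μ → B, wordWeight θ b μ ω ∈ logLipCone S M₀) →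
      ∀ f ∈ logLipCone S (M₀ / (1 - (κ : ℝ))), (L ^ μ) f ∈ logLipCone S (M₀ / (1 - (κ : ℝ))) :=
    fun M₀ hM₀ hw f hf => by
      have := transferOperator_pow_mem_logLipCone hpos hsum hcont hcontr
        (div_nonneg hM₀.le hκ1.le) hw hf
      rwa [show M₀ + κ * (M₀ / (1 - (κ : ℝ))) = M₀ / (1 - (κ : ℝ)) by field_simp; ring] at this
  obtain ⟨M₀, hM₀, hw⟩ := hcone
  obtain ⟨R, v, hR, hv, hTv, hvK⟩ := exists_pos_eigenvector (hL.pow μ) hT'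
    (div_nonneg hM₀.le hκ1.le) (hinv M₀ hM₀ hw)
  set M := M₀ / (1 - (κ : ℝ)) with hM
  have hMpos : 0 < M := div_pos hM₀ hκ1
  have hM₀M : M₀ + κ * M = M := by rw [hM]; field_simp; ring
  have hvM : v ∈ logLipCone S M := hvK M hMpos.le (hinv M₀ hM₀ hw)
  have hQv : (R⁻¹ • L ^ μ) v = v := by
    rw [smul_apply, hTv, smul_smul, inv_mul_cancel₀ hR.ne', one_smul]
  have hQ : PreservesNonneg (R⁻¹ • L ^ μ) := fun f hf x =>
    mul_nonneg (inv_nonneg.2 hR.le) (hL.pow μ f hf x)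
  have hnear : ∀ (f : C(S, ℝ)) (ε : ℝ), 0 < ε →
      ∀ᶠ n in atTop, ∃ t : ℝ, ‖((R⁻¹ • L ^ μ) ^ n) f - t • v‖ ≤ ε := fun f ε hε => by
    -- At `M` itself the cone is only invariant; enlarging to `M + 1` gives image parameter `M + κ <
    -- M + 1`, the strict gain required.
    refine eventually_near_span (M' := M₀ + κ * (M + 1)) (M := M + 1) hQ hQv (by positivity)
      (by linarith) (logLipCone_mono (by linarith [κ.2]) hvM) (fun f hf => ?_) hv f hε
    exact logLipCone_smul_mem (transferOperator_pow_mem_logLipCone hpos hsum hcont hcontr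
      (by positivity) hw hf) (inv_nonneg.2 hR.le)
  -- `L` commutes with its power, so `L v` is fixed by `R⁻¹ • L ^ μ`; convergence to the line of `v`
  -- then forces it onto that line.
  obtain ⟨ρ, hρv⟩ : ∃ ρ : ℝ, ρ • v = L v := by
    have hfix : (R⁻¹ • L ^ μ) (L v) = (1 : ℝ) • L v := by
      rw [smul_apply, ← mul_apply_eq_comp, ← pow_succ, pow_succ',
        mul_apply_eq_comp, ← map_smul, ← smul_apply, hQv, one_smul]
    refine Submodule.mem_span_singleton.1 (mem_span_singleton_of_forall_near fun ε hε => ?_)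
    obtain ⟨n, t, ht⟩ := (hnear (L v) ε hε).exists
    rw [pow_apply_eq_smul hfix, one_pow, one_smul] at ht
    exact ⟨t, ht⟩
  obtain ⟨x₀⟩ := ‹Nonempty S›
  have : Nonempty S := ⟨x₀⟩
  have hρ : 0 < ρ := by
    have h1 := hL' v hv x₀
    rw [← hρv] at h1
    exact pos_of_mul_pos_left h1 (hv x₀).le
  have hRρ : R = ρ ^ μ := by
    have h1 := pow_apply_eq_smul hρv.symm μ
    rw [hTv] at h1
    have h2 : R * v x₀ = ρ ^ μ * v x₀ := congrArg (fun g : C(S, ℝ) => g x₀) h1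
    exact mul_right_cancel₀ (hv x₀).ne' h2
  rw [hRρ] at hnear
  rw [specRadius_eq hL hv hρ hρv.symm]
  exact ⟨hρ, ⟨v, hv, hρv.symm, fun N hN hNw => hvK _ (div_nonneg hN.le hκ1.le) (hinv N hN hNw)⟩,
    algMultiplicity_eq_one hρ hv hρv.symm hnear,
    fun z hz hzρ => eq_of_isEigenvalue_of_norm_eq hρ hρv.symm hnear hz hzρ⟩

end Main

end PositiveTransfer

end

open PositiveTransfer in
theorem mainTheorem11
    {E : Type*} [NormedAddCommGroup E] [NormedSpace ℝ E] [FiniteDimensional ℝ E]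
    (H : Set E) (hHo : IsOpen H) (hHb : Bornology.IsBounded H) (hHne : H.Nonempty)
    {B : Type*} [Countable B] [Infinite B]
    (θ : B → C(closure H, closure H)) (b : B → C(closure H, ℝ))
    (hpos : ∀ β x, 0 < b β x)
    (hθLip : UniformlyLipschitz fun β x => θ β x)
    (hbLip : UniformlyLipschitz fun β x => b β x)
    (hsum : ∀ x, Summable fun β => b β x)
    (hcont : Continuous fun x => ∑' β, b β x)
    (μ : ℕ) (hμ : 1 ≤ μ) (κ : NNReal) (hκ : κ < 1)
    (hcontr : ∀ ω : Fin μ → B, LipschitzWith κ (wordMap θ μ ω))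
    (hlogLip : UniformlyLipschitz fun β x => Real.log (b β x)) :
    (∃ A : NNReal, ∀ ν : ℕ, 1 ≤ ν → (0 < κ ∨ μ ≤ ν) → ∀ ω : Fin ν → B,
      LipschitzWith (A * (κ ^ (1 / (μ : ℝ))) ^ ν) (wordMap θ ν ω)) ∧
    (∀ ν : ℕ, 1 ≤ ν →
      UniformlyLipschitz fun (ω : Fin ν → B) x => Real.log (wordWeight θ b ν ω x)) ∧
    (∃ M₀ : ℝ, 0 < M₀ ∧
      ∀ ω : Fin μ → B, wordWeight θ b μ ω ∈ logLipCone (closure H) M₀) ∧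
    haveI : CompactSpace (closure H) := isCompact_iff_compactSpace.mp hHb.isCompact_closure
    let L : C(closure H, ℝ) →L[ℝ] C(closure H, ℝ) := transferOperator θ b hpos hsum hcont
    0 < specRadius L ∧
    (∃ v : C(closure H, ℝ),
      (∀ x, 0 < v x) ∧ L v = specRadius L • v ∧
      ∀ M₀ : ℝ, 0 < M₀ →
        (∀ ω : Fin μ → B, wordWeight θ b μ ω ∈ logLipCone (closure H) M₀) →
        v ∈ logLipCone (closure H) (M₀ / (1 - (κ : ℝ)))) ∧
    algMultiplicity L (specRadius L) = 1 ∧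
    ∀ z : ℂ, IsEigenvalue L z → ‖z‖ = specRadius L → z = specRadius L := by
  have : Nonempty (closure H) := hHne.closure.to_subtype
  have : CompactSpace (closure H) := isCompact_iff_compactSpace.mp hHb.isCompact_closure
  have hcone := exists_wordWeight_mem_logLipCone hpos hθLip hlogLip μ
  exact ⟨exists_lipschitzWith_wordMap hθLip hμ hκ hcontr,
    fun ν _ => uniformlyLipschitz_log_wordWeight hpos hθLip hlogLip ν, hcone,
    transferOperator_perron hpos hsum hcont hκ hcontr hcone⟩
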